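/- Let $F$ be a real Banach lattice with norm dual $F^*$, equipped with its usual order and norm. For a Banach lattice $G$, the norm of $G$ is order continuous if every net decreasing to $0$ in order converges to $0$ in norm, and $G_a$ denotes the largest order ideal of $G$ on which the norm is order continuous. The aw-topology on $F$ is the linear topology generated by the seminorms $f\mapsto\nu(|f|)$ with $0\le\nu\in F^*$; the aaw-topology is the linear topology generated by those seminorms with $0\le\nu\in(F^*)_a$. A sequence $(f_n)_{n\in\mathbb{N}}$ in $F$ is disjoint if $|f_i|\wedge|f_j|=0$ for $i\neq j$. Let $S_F$ denote the unit sphere of $F$, and $S_E=S_F\cap E$ for a subspace $E\subset F$. A topology on $F$ is boundedly exhaustive if every norm-bounded disjoint sequence in $F$ is null with respect to it. Let $H$ be a Banach space and let $T:F\to H$ be a bounded linear operator. $T$ complements the aw-topology if there is no net $(f_p)$ in $S_F$ which is aw-null and satisfies $\|Tf_p\|\to0$. $T$ is DNS if, for every disjoint sequence $(f_n)$ of non-zero vectors of $F$, there is an infinite-dimensional subspace of $\mathrm{span}\{f_n\}_{n\in\mathbb{N}}$ on which $T$ is bounded from below (that is, the restriction of $T$ to this span is not strictly singular). $T$ is $\infty$-DNS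 if there is $r>0$ such that there is no disjoint sequence $(f_k)_{k\in\mathbb{N}}$ in $S_F$ with $\|Tf_k\|\le r$ for every $k$. A closed subspace $E\subset F$ is dispersed if there is no sequence $(e_n)$ in $S_E$ for which there is a disjoint sequence $(f_n)$ in $F$ with $\|f_n-e_n\|\to0$. It is $\infty$-dispersed if there is $r>0$ such that there is no disjoint sequence $(f_k)_{k\in\mathbb{N}}$ in $S_F$ with $\mathrm{dist}(f_k,E)<r$ for every $k$. Then the following conditions are equivalent: (i) $F^*$ has order continuous norm; (ii) the aw- and aaw-topologies on $F$ coincide; (iii) the aw-topology is boundedly exhaustive; (iv) for every Banach space $H$, every bounded linear operator $T:F\to H$ which complements the aw-topology is DNS; (iv$_\infty$) for every Banach space $H$, every bounded linear operator $T:F\to H$ which complements the aw-topology is $\infty$-DNS; (v) every closed subspace of $F$ on which the aw-topology agrees with the norm topology is dispersed; (v$_\infty$) every closed subspace of $F$ on which the aw-topology agrees with the norm topology is $\infty$-dispersed; (vi) for every disjoint sequence of non-zero vectors of $F$, the aw-topology does not agree with the norm topology on the closed linear span of the sequence. -/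

import Mathlib

open Filter Topology

universe u v

/-! ### Order continuity of norms -/

section OrderContinuity

variable (E : Type u) [NormedAddCommGroup E] [PartialOrder E]

/-- The norm of `E` is order continuous: every net decreasing to `0` (in the order) is norm null.
A decreasing net is given by its range, a non-empty downward directed set with infimum `0`; as the
norm of a normed lattice is monotone on positive elements, the net is norm null iff its range
contains elements of arbitrarily small norm. -/
def HasOrderContinuousNorm : Prop :=
  ∀ D : Set E, D.Nonempty → DirectedOn (fun x y => y ≤ x) D → IsGLB D 0 →
    ∀ ε : ℝ, 0 < ε → ∃ d ∈ D, ‖d‖ < ε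

variable {E}

/-- `|y| ≤ |x|`, expressed through the order only: every upper bound of `{x, -x}` is an upper bound
of `{y, -y}` (see `absLE_iff_abs_le_abs`). -/
def AbsLE (y x : E) : Prop :=
  ∀ z : E, x ≤ z → -x ≤ z → y ≤ z ∧ -y ≤ z

variable [NormedSpace ℝ E]

/-- A linear subspace is an (order) ideal if it is solid. -/
def IsOrderIdeal (I : Submodule ℝ E) : Prop :=
  ∀ x ∈ I, ∀ y : E, AbsLE y x → y ∈ I

variable (E) in
/-- The order continuous part `E_a` of `E`: the largest ideal of `E` on which the norm is order
continuous, described as the union of all such ideals. -/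
def orderContinuousPart : Set E :=
  {x | ∃ I : Submodule ℝ E, IsOrderIdeal I ∧ HasOrderContinuousNorm I ∧ x ∈ I}

end OrderContinuity

theorem absLE_iff_abs_le_abs {E : Type u} [NormedAddCommGroup E] [Lattice E] (x y : E) :
    AbsLE y x ↔ |y| ≤ |x| := by
  constructor
  · intro h
    obtain ⟨h1, h2⟩ := h |x| le_sup_left le_sup_right
    exact sup_le h1 h2
  · intro h z h1 h2
    have hz : |x| ≤ z := sup_le h1 h2
    exact ⟨le_sup_left.trans (h.trans hz), le_sup_right.trans (h.trans hz)⟩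

/-! ### The dual of a Banach lattice and its order -/

section Dual

variable {F : Type u} [NormedAddCommGroup F] [NormedSpace ℝ F] [Lattice F] [IsOrderedAddMonoid F]

/-- The order of the dual of a Banach lattice: `φ ≤ ψ` iff `φ f ≤ ψ f` for every `f ≥ 0`. -/
instance dualPartialOrder : PartialOrder (StrongDual ℝ F) where
  le φ ψ := ∀ f : F, 0 ≤ f → φ f ≤ ψ f
  le_refl _ _ _ := le_rfl
  le_trans _ _ _ h₁ h₂ f hf := (h₁ f hf).trans (h₂ f hf)
  le_antisymm φ ψ h₁ h₂ := by
    have key : ∀ f : F, 0 ≤ f → φ f = ψ f := fun f hf => le_antisymm (h₁ f hf) (h₂ f hf)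
    ext f
    rw [← posPart_sub_negPart f, map_sub, map_sub, key _ (posPart_nonneg f),
      key _ (negPart_nonneg f)]

theorem dual_le_iff (φ ψ : StrongDual ℝ F) : φ ≤ ψ ↔ ∀ f : F, 0 ≤ f → φ f ≤ ψ f := Iff.rfl

theorem zero_mem_orderContinuousPart_dual :
    (0 : StrongDual ℝ F) ∈ orderContinuousPart (StrongDual ℝ F) := by
  refine ⟨⊥, ?_, ?_, Submodule.zero_mem _⟩
  · intro x hx y hy
    rw [Submodule.mem_bot] at hx ⊢
    subst hx
    obtain ⟨h1, h2⟩ := hy 0 le_rfl (by simp)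
    refine le_antisymm h1 fun f hf => ?_
    have := h2 f hf
    simpa using this
  · intro D ⟨d, hd⟩ _ _ ε hε
    refine ⟨d, hd, ?_⟩
    rw [Subsingleton.elim d 0, norm_zero]
    exact hε

end Dual

/-! ### Absolute weak topologies -/

section AbsoluteWeak

variable {F : Type u} [NormedAddCommGroup F] [NormedSpace ℝ F] [Lattice F] [IsOrderedAddMonoid F]
  [IsOrderedModule ℝ F]

theorem lattice_abs_smul (c : ℝ) (f : F) : |c • f| = |c| • |f| := by
  have key : ∀ (c : ℝ) (f : F), |c • f| ≤ |c| • |f| := by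
    intro c f
    have h1 : ∀ (c : ℝ) (f : F), 0 ≤ c → |c • f| ≤ c • |f| := by
      intro c f hc
      refine sup_le (smul_le_smul_of_nonneg_left le_sup_left hc) ?_
      rw [← smul_neg]
      exact smul_le_smul_of_nonneg_left le_sup_right hc
    rcases le_total 0 c with hc | hc
    · rw [abs_of_nonneg hc]; exact h1 c f hc
    · rw [abs_of_nonpos hc]
      have := h1 (-c) f (neg_nonneg.mpr hc)
      rwa [neg_smul, abs_neg] at this
  refine le_antisymm (key c f) ?_
  rcases eq_or_ne c 0 with rfl | hc
  · simp
  · have h := key c⁻¹ (c • f)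
    rw [smul_smul, inv_mul_cancel₀ hc, one_smul] at h
    have h' := smul_le_smul_of_nonneg_left h (abs_nonneg c)
    rwa [smul_smul, abs_inv, mul_inv_cancel₀ (abs_ne_zero.mpr hc), one_smul] at h'

/-- The seminorm `f ↦ ν(|f|)` given by a positive functional `ν`. -/
noncomputable def absSeminorm (ν : StrongDual ℝ F) (hν : 0 ≤ ν) : Seminorm ℝ F :=
  Seminorm.of (fun f => ν |f|)
    (fun f g => by
      have h := hν (|f| + |g| - |f + g|) (sub_nonneg.mpr (abs_add_le f g))
      simp only [zero_apply, map_sub, map_add] at h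
      linarith)
    (fun c f => by rw [lattice_abs_smul, map_smul, smul_eq_mul, Real.norm_eq_abs])

theorem absSeminorm_apply (ν : StrongDual ℝ F) (hν : 0 ≤ ν) (f : F) :
    absSeminorm ν hν f = ν |f| := rfl

/-- The absolute weak topology `|σ|(F, A)` on `F` given by a set `A` of functionals: the linear
topology generated by the seminorms `f ↦ ν(|f|)`, where `0 ≤ ν ∈ A`. -/
@[reducible] noncomputable def absoluteWeakTopology (A : Set (StrongDual ℝ F))
    [Nonempty {ν : StrongDual ℝ F // ν ∈ A ∧ 0 ≤ ν}] : TopologicalSpace F :=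
  SeminormFamily.moduleFilterBasis (𝕜 := ℝ)
    (fun ν : {ν : StrongDual ℝ F // ν ∈ A ∧ 0 ≤ ν} => absSeminorm ν.1 ν.2.2) |>.topology

instance nonempty_univ_pos :
    Nonempty {ν : StrongDual ℝ F // ν ∈ (Set.univ : Set (StrongDual ℝ F)) ∧ 0 ≤ ν} :=
  ⟨0, trivial, le_rfl⟩

instance nonempty_orderContinuousPart_pos :
    Nonempty {ν : StrongDual ℝ F // ν ∈ orderContinuousPart (StrongDual ℝ F) ∧ 0 ≤ ν} :=
  ⟨0, zero_mem_orderContinuousPart_dual, le_rfl⟩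

variable (F)

/-- The absolute weak (aw-) topology of `F`, generated by all the positive functionals. -/
@[reducible] noncomputable def awTopology : TopologicalSpace F :=
  absoluteWeakTopology (Set.univ : Set (StrongDual ℝ F))

/-- The aaw-topology of `F`, generated by the positive functionals in the order continuous part
`(F^*)_a` of the dual. -/
@[reducible] noncomputable def aawTopology : TopologicalSpace F :=
  absoluteWeakTopology (orderContinuousPart (StrongDual ℝ F))

end AbsoluteWeak

/-! ### Disjoint sequences, exhaustive topologies, complementing seminorms -/

/-- The sequence `f` is disjoint: `|f i| ∧ |f j| = 0` whenever `i ≠ j`. -/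
def IsDisjointSeq {F : Type u} [AddCommGroup F] [Lattice F] (f : ℕ → F) : Prop :=
  ∀ i j, i ≠ j → |f i| ⊓ |f j| = 0

/-- Every norm bounded disjoint sequence is null with respect to `τ`. -/
def IsBoundedlyExhaustive {F : Type u} [NormedAddCommGroup F] [Lattice F]
    (τ : TopologicalSpace F) : Prop :=
  ∀ f : ℕ → F, IsDisjointSeq f → Bornology.IsBounded (Set.range f) →
    Tendsto f atTop (@nhds F τ 0)

/-- `τ` agrees with the norm topology on the subspace `E`: the topology induced by `τ` on `E` is the
topology of the norm of `E`. -/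
def AgreesWithNormOn {F : Type u} [NormedAddCommGroup F] [NormedSpace ℝ F]
    (τ : TopologicalSpace F) (E : Submodule ℝ F) : Prop :=
  TopologicalSpace.induced (fun e : E => (e : F)) τ =
    (PseudoMetricSpace.toUniformSpace (α := E)).toTopologicalSpace

/-- The seminorm `ρ` complements `τ`: no net (equivalently, no proper filter) in the unit sphere is
both `τ`-null and `ρ`-null. -/
def Complements {F : Type u} [NormedAddCommGroup F] [NormedSpace ℝ F]
    (ρ : Seminorm ℝ F) (τ : TopologicalSpace F) : Prop :=
  ¬ ∃ l : Filter F, l.NeBot ∧ (∀ᶠ f in l, ‖f‖ = 1) ∧ Tendsto id l (@nhds F τ 0) ∧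
    Tendsto ρ l (𝓝 0)

/-- The seminorm `f ↦ ‖T f‖` of an operator `T`. -/
noncomputable def operatorSeminorm {F : Type u} {H : Type v} [NormedAddCommGroup F]
    [NormedSpace ℝ F] [NormedAddCommGroup H] [NormedSpace ℝ H] (T : F →L[ℝ] H) : Seminorm ℝ F :=
  (normSeminorm ℝ H).comp (T : F →ₗ[ℝ] H)

/-! ### DNS operators and dispersed subspaces -/

section DNS

variable {F : Type u} {H : Type v} [NormedAddCommGroup F] [NormedSpace ℝ F]
  [NormedAddCommGroup H] [NormedSpace ℝ H]

/-- The restriction of `T` to the subspace `E` is strictly singular: `T` is not bounded from below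
on any infinite-dimensional subspace `G` of `E`. -/
def IsStrictlySingularOn (T : F →L[ℝ] H) (E : Submodule ℝ F) : Prop :=
  ∀ G : Submodule ℝ F, G ≤ E → ¬ FiniteDimensional ℝ G →
    ¬ ∃ c : ℝ, 0 < c ∧ ∀ g ∈ G, c * ‖g‖ ≤ ‖T g‖

variable [Lattice F]

/-- `T` is disjointly non-singular: its restriction to the span of any disjoint sequence (of
non-zero vectors) is not strictly singular. -/
def IsDNS (T : F →L[ℝ] H) : Prop :=
  ∀ f : ℕ → F, IsDisjointSeq f → (∀ n, f n ≠ 0) →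
    ¬ IsStrictlySingularOn T (Submodule.span ℝ (Set.range f))

/-- `T` is `∞`-DNS: for some `r > 0` there is no disjoint sequence of unit vectors with
`‖T f_k‖ ≤ r` for every `k`. -/
def IsInftyDNS (T : F →L[ℝ] H) : Prop :=
  ∃ r : ℝ, 0 < r ∧ ¬ ∃ f : ℕ → F, IsDisjointSeq f ∧ (∀ k, ‖f k‖ = 1) ∧ ∀ k, ‖T (f k)‖ ≤ r

/-- `E` is dispersed: it contains no almost disjoint sequence, that is, no sequence of unit vectors
of `E` whose distance to some disjoint sequence of `F` tends to `0`. -/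
def IsDispersed (E : Submodule ℝ F) : Prop :=
  ¬ ∃ e f : ℕ → F, (∀ n, e n ∈ E ∧ ‖e n‖ = 1) ∧ IsDisjointSeq f ∧
    Tendsto (fun n => ‖f n - e n‖) atTop (𝓝 0)

/-- `E` is `∞`-dispersed: for some `r > 0` there is no disjoint sequence of unit vectors of `F` at
distance less than `r` from `E`. -/
def IsInftyDispersed (E : Submodule ℝ F) : Prop :=
  ∃ r : ℝ, 0 < r ∧ ¬ ∃ f : ℕ → F, IsDisjointSeq f ∧ (∀ k, ‖f k‖ = 1) ∧
    ∀ k, Metric.infDist (f k) (E : Set F) < r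

end DNS

/-! Everything reduces to whether `ν |f n| → 0` for each positive functional `ν` and each bounded
disjoint sequence `f`.

If `ν` lies in the order continuous part of the dual, the components of `ν` carried by the tails of
`f` decrease to `0`, because disjoint pieces of a vector `x` cannot carry total mass above `ν x`.
Their norms then tend to `0`, which forces `ν |f n| → 0`:
`tendsto_apply_abs_of_mem_orderContinuousPart`.

Conversely, if the dual norm is not order continuous, a disjointification yields positive disjoint
vectors in the unit ball on which some `ν` is at least `δ > 0`
(`exists_disjoint_of_not_hasOrderContinuousNorm`). They span a copy of `ℓ¹` on which `ν |·|` is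
equivalent to the norm, contradicting the last condition.

The conditions in between rest on `Complements.exists_dual`: a complementing `T` is bounded below at
unit vectors where one fixed `ν |·|` is small, hence far along a disjoint sequence. Dispersed
subspaces are treated through their quotient maps, which complement the aw-topology
(`complements_quotientULift`). -/

/-! ### Disjointness in lattice-ordered groups -/

section Lattice

variable {G : Type u} [AddCommGroup G] [Lattice G]

theorem inf_eq_zero_of_le {a b a' b' : G} (ha : 0 ≤ a) (hb : 0 ≤ b) (haa : a ≤ a')
    (hbb : b ≤ b') (h : a' ⊓ b' = 0) : a ⊓ b = 0 :=
  le_antisymm ((inf_le_inf haa hbb).trans h.le) (le_inf ha hb)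

theorem IsDisjointSeq.comp {f : ℕ → G} (hf : IsDisjointSeq f) {k : ℕ → ℕ}
    (hk : Function.Injective k) : IsDisjointSeq (f ∘ k) :=
  fun i j hij => hf (k i) (k j) (hk.ne hij)

/-- `u` is supported on the block `f m, …, f (n - 1)`: it is disjoint from everything disjoint
from the block. -/
def SupportedOnBlock (f : ℕ → G) (m n : ℕ) (u : G) : Prop :=
  0 ≤ u ∧ ∀ v, 0 ≤ v → (∀ i, m ≤ i → i < n → v ⊓ |f i| = 0) → v ⊓ u = 0

theorem SupportedOnBlock.mono {f : ℕ → G} {m n m' n' : ℕ} {u : G}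
    (h : SupportedOnBlock f m n u) (hm : m' ≤ m) (hn : n ≤ n') : SupportedOnBlock f m' n' u :=
  ⟨h.1, fun v hv hvi => h.2 v hv fun i h1 h2 => hvi i (hm.trans h1) (h2.trans_le hn)⟩

end Lattice

section LatticeGroup

variable {G : Type u} [AddCommGroup G] [Lattice G] [IsOrderedAddMonoid G]

theorem add_inf_le_inf_add_inf {x y u : G} (hx : 0 ≤ x) (hy : 0 ≤ y) (hu : 0 ≤ u) :
    (x + y) ⊓ u ≤ x ⊓ u + y ⊓ u := by
  rw [inf_add, add_inf, add_inf]
  exact le_inf (le_inf inf_le_left (inf_le_right.trans (le_add_of_nonneg_left hx)))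
    (le_inf (inf_le_right.trans (le_add_of_nonneg_right hy))
      (inf_le_right.trans (le_add_of_nonneg_right hu)))

theorem inf_add_inf_le_add_inf_add (x y u v : G) : x ⊓ u + y ⊓ v ≤ (x + y) ⊓ (u + v) :=
  le_inf (add_le_add inf_le_left inf_le_left) (add_le_add inf_le_right inf_le_right)

theorem inf_add_eq_zero {x y u : G} (hx : 0 ≤ x) (hy : 0 ≤ y) (hu : 0 ≤ u)
    (hxu : u ⊓ x = 0) (hyu : u ⊓ y = 0) : u ⊓ (x + y) = 0 := by
  refine le_antisymm ?_ (le_inf hu (add_nonneg hx hy))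
  have := add_inf_le_inf_add_inf hx hy hu
  rwa [inf_comm x, inf_comm y, hxu, hyu, add_zero, inf_comm] at this

/-- The two pieces of `x` are disjoint, so their sum is their supremum. -/
theorem inf_add_inf_le_inf_add {x u w : G} (hx : 0 ≤ x) (hu : 0 ≤ u) (hw : 0 ≤ w)
    (h : u ⊓ w = 0) : x ⊓ u + x ⊓ w ≤ x ⊓ (u + w) := by
  have h0 : (x ⊓ u) ⊓ (x ⊓ w) = 0 :=
    inf_eq_zero_of_le (le_inf hx hu) (le_inf hx hw) inf_le_right inf_le_right h
  rw [← inf_add_sup, h0, zero_add]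
  exact sup_le (inf_le_inf le_rfl (le_add_of_nonneg_right hw))
    (inf_le_inf le_rfl (le_add_of_nonneg_left hu))

/-- Disjointness turns `|a| + |b|` into `||a| - |b||`, which the reverse triangle inequality bounds
by `|a + b|`. -/
theorem abs_add_of_disjoint {a b : G} (h : |a| ⊓ |b| = 0) : |a + b| = |a| + |b| := by
  refine le_antisymm (abs_add_le a b) ?_
  have h1 : |a| + |b| = |(|a| - |b|)| := by
    rw [← sup_sub_inf_eq_abs_sub, sup_comm, inf_comm, h, sub_zero, ← inf_add_sup, h, zero_add]
  have h2 := abs_abs_sub_abs_le a (-b)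
  rwa [abs_neg, sub_neg_eq_add, ← h1] at h2

end LatticeGroup

/-! ### Constructing functionals from the positive cone -/

section NormedLattice

variable {F : Type u} [NormedAddCommGroup F] [Lattice F] [IsOrderedAddMonoid F]

theorem norm_le_norm_of_nonneg_of_le [HasSolidNorm F] {x y : F} (hx : 0 ≤ x) (hxy : x ≤ y) : ‖x‖ ≤ ‖y‖ :=
  norm_le_norm_of_abs_le_abs (by rwa [abs_of_nonneg hx, abs_of_nonneg (hx.trans hxy)])

variable [NormedSpace ℝ F]

theorem dual_mono {ν : StrongDual ℝ F} (hν : 0 ≤ ν) {x y : F} (h : x ≤ y) : ν x ≤ ν y := by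
  have := hν (y - x) (sub_nonneg.mpr h)
  simp only [zero_apply, map_sub] at this
  linarith

theorem dual_apply_nonneg {ν : StrongDual ℝ F} (hν : 0 ≤ ν) {x : F} (h : 0 ≤ x) : 0 ≤ ν x := by
  simpa using dual_mono hν h

theorem abs_dual_apply_le {ν : StrongDual ℝ F} (hν : 0 ≤ ν) (x : F) : |ν x| ≤ ν |x| :=
  abs_le'.mpr ⟨dual_mono hν (le_abs_self x), by
    rw [← map_neg]; exact dual_mono hν (neg_le_abs x)⟩

theorem dual_apply_abs_le [HasSolidNorm F] (ν : StrongDual ℝ F) (x : F) : ν |x| ≤ ‖ν‖ * ‖x‖ := by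
  have := ν.le_opNorm |x|
  rw [norm_abs_eq_norm] at this
  exact (Real.le_norm_self _).trans this

variable [HasSolidNorm F]

/-- A positive additive function on the positive cone which is dominated by a functional extends to
a functional. -/
theorem exists_dual_eq_of_additive {ν : StrongDual ℝ F} (p : F → ℝ)
    (hadd : ∀ x y, 0 ≤ x → 0 ≤ y → p (x + y) = p x + p y) (h0 : ∀ x, 0 ≤ x → 0 ≤ p x)
    (hle : ∀ x, 0 ≤ x → p x ≤ ν x) : ∃ φ : StrongDual ℝ F, ∀ x, 0 ≤ x → φ x = p x := by
  let q : F →+ ℝ := AddMonoidHom.mk' (fun x => p x⁺ - p x⁻) (by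
    intro x y
    have e : (x + y)⁺ + (x⁻ + y⁻) = (x + y)⁻ + (x⁺ + y⁺) := by
      have h1 := posPart_sub_negPart (x + y)
      have h2 := posPart_sub_negPart x
      have h3 := posPart_sub_negPart y
      rw [sub_eq_iff_eq_add] at h1 h2 h3
      rw [h1, h2, h3]
      abel
    have e' := congrArg p e
    rw [hadd _ _ (posPart_nonneg _) (add_nonneg (negPart_nonneg _) (negPart_nonneg _)),
      hadd _ _ (negPart_nonneg _) (negPart_nonneg _),
      hadd _ _ (negPart_nonneg _) (add_nonneg (posPart_nonneg _) (posPart_nonneg _)),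
      hadd _ _ (posPart_nonneg _) (posPart_nonneg _)] at e'
    linarith)
  have hq : ∀ x, q x = p x⁺ - p x⁻ := fun x => rfl
  -- An additive continuous map is real-linear, so homogeneity of `p` is never needed.
  have hc : Continuous q := by
    refine AddMonoidHomClass.continuous_of_bound q ‖ν‖ fun x => ?_
    have h1 := dual_apply_abs_le ν x
    rw [← posPart_add_negPart, map_add] at h1
    have h2 := h0 _ (posPart_nonneg x)
    have h3 := h0 _ (negPart_nonneg x)
    have h4 := hle _ (posPart_nonneg x)
    have h5 := hle _ (negPart_nonneg x)
    rw [Real.norm_eq_abs, hq, abs_le]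
    constructor <;> linarith
  have hp0 : p 0 = 0 := by simpa using hadd 0 0 le_rfl le_rfl
  refine ⟨q.toRealLinearMap hc, fun x hx => ?_⟩
  change q x = p x
  rw [hq, posPart_of_nonneg hx, negPart_of_nonneg hx, hp0, sub_zero]

/-- The component of a positive functional `ν` carried by an additive set of positive vectors. -/
theorem exists_dual_component {ν : StrongDual ℝ F} (hν : 0 ≤ ν) (S : AddSubmonoid F)
    (hS : ∀ u ∈ S, 0 ≤ u) : ∃ φ : StrongDual ℝ F, 0 ≤ φ ∧ φ ≤ ν ∧
      (∀ x, 0 ≤ x → ∀ u ∈ S, ν (x ⊓ u) ≤ φ x) ∧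
      ∀ x, 0 ≤ x → ∀ c, (∀ u ∈ S, ν (x ⊓ u) ≤ c) → φ x ≤ c := by
  let p : F → ℝ := fun x => ⨆ u : S, ν (x ⊓ u)
  have hb : ∀ x, BddAbove (Set.range fun u : S => ν (x ⊓ u)) := fun x =>
    ⟨ν x, by rintro _ ⟨u, rfl⟩; exact dual_mono hν inf_le_left⟩
  have hle : ∀ x, ∀ u ∈ S, ν (x ⊓ u) ≤ p x := fun x u hu => le_ciSup (hb x) (⟨u, hu⟩ : S)
  have hp0 : ∀ x, 0 ≤ x → 0 ≤ p x := fun x hx => by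
    have := hle x 0 S.zero_mem
    rwa [inf_eq_right.mpr hx, map_zero] at this
  have hpν : ∀ x, p x ≤ ν x := fun x => ciSup_le fun u => dual_mono hν inf_le_left
  obtain ⟨φ, hφ⟩ := exists_dual_eq_of_additive (ν := ν) p (by
    intro x y hx hy
    refine le_antisymm (ciSup_le fun u => ?_) ?_
    · refine (dual_mono hν (add_inf_le_inf_add_inf hx hy (hS u u.2))).trans ?_
      rw [map_add]
      exact add_le_add (hle x u u.2) (hle y u u.2)
    -- Superadditivity uses that `S` is closed under addition: `x ⊓ u + y ⊓ w` lies below `(x + y) ⊓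
    -- (u + w)`.
    · rw [← le_sub_iff_add_le]
      refine ciSup_le fun u => ?_
      rw [le_sub_comm]
      refine ciSup_le fun w => ?_
      rw [le_sub_iff_add_le, add_comm, ← map_add]
      exact (dual_mono hν (inf_add_inf_le_add_inf_add _ _ _ _)).trans
        (hle _ _ (S.add_mem u.2 w.2))) hp0 (fun x _ => hpν x)
  refine ⟨φ, fun x hx => ?_, fun x hx => ?_, fun x hx u hu => ?_, fun x hx c hc => ?_⟩
  · simpa [hφ x hx] using hp0 x hx
  · rw [hφ x hx]; exact hpν x
  · rw [hφ x hx]; exact hle x u hu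
  · rw [hφ x hx]; exact ciSup_le fun u => hc u u.2

end NormedLattice

/-! ### Linear combinations of disjoint sequences -/

section VectorLattice

variable {F : Type u} [NormedAddCommGroup F] [NormedSpace ℝ F] [Lattice F] [IsOrderedAddMonoid F]
  [IsOrderedModule ℝ F]

theorem inf_smul_eq_zero {a b : F} {c : ℝ} (ha : 0 ≤ a) (hb : 0 ≤ b) (hc : 0 ≤ c)
    (h : a ⊓ b = 0) : a ⊓ c • b = 0 := by
  have hz : 0 ≤ a ⊓ c • b := le_inf ha (smul_nonneg hc hb)
  -- Dividing by `c + 1` brings the infimum below both `a` and `b`, and also covers `c = 0`.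
  have hk : 0 < c + 1 := by linarith
  have h1 : (c + 1)⁻¹ • (a ⊓ c • b) ≤ a ⊓ b := by
    refine le_inf ?_ ?_
    · calc (c + 1)⁻¹ • (a ⊓ c • b) ≤ (1 : ℝ) • (a ⊓ c • b) :=
            smul_le_smul_of_nonneg_right (inv_le_one_of_one_le₀ (by linarith)) hz
        _ ≤ a := by rw [one_smul]; exact inf_le_left
    · calc (c + 1)⁻¹ • (a ⊓ c • b) ≤ (c + 1)⁻¹ • (c • b) :=
            smul_le_smul_of_nonneg_left inf_le_right (inv_nonneg.mpr hk.le)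
        _ = ((c + 1)⁻¹ * c) • b := smul_smul _ _ _
        _ ≤ (1 : ℝ) • b := by
            refine smul_le_smul_of_nonneg_right ?_ hb
            rw [inv_mul_le_iff₀ hk]; linarith
        _ = b := one_smul _ _
  refine le_antisymm ?_ hz
  have h2 := smul_le_smul_of_nonneg_left (h1.trans h.le) hk.le
  rwa [smul_smul, mul_inv_cancel₀ hk.ne', one_smul, smul_zero] at h2

theorem IsDisjointSeq.abs_sum_smul {f : ℕ → F} (hf : IsDisjointSeq f) (a : ℕ → ℝ)
    (s : Finset ℕ) : |∑ i ∈ s, a i • f i| = ∑ i ∈ s, |a i| • |f i| := by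
  classical
  -- The second conjunct keeps each new term disjoint from the partial sum, as the induction
  -- requires.
  have key : ∀ s : Finset ℕ, |∑ i ∈ s, a i • f i| = ∑ i ∈ s, |a i| • |f i| ∧
      ∀ j ∉ s, |f j| ⊓ |∑ i ∈ s, a i • f i| = 0 := by
    intro s
    induction s using Finset.induction_on with
    | empty => simp
    | insert k s hk ih =>
      obtain ⟨ih1, ih2⟩ := ih
      have h1 : |a k • f k| ⊓ |∑ i ∈ s, a i • f i| = 0 := by
        rw [lattice_abs_smul, inf_comm]
        exact inf_smul_eq_zero (abs_nonneg _) (abs_nonneg _) (abs_nonneg _)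
          (by rw [inf_comm]; exact ih2 k hk)
      rw [Finset.sum_insert hk, Finset.sum_insert hk, abs_add_of_disjoint h1]
      refine ⟨by rw [ih1, lattice_abs_smul], fun j hj => ?_⟩
      rw [Finset.mem_insert, not_or] at hj
      refine inf_add_eq_zero (abs_nonneg _) (abs_nonneg _) (abs_nonneg _) ?_ (ih2 j hj.2)
      rw [lattice_abs_smul]
      exact inf_smul_eq_zero (abs_nonneg _) (abs_nonneg _) (abs_nonneg _) (hf j k hj.1)
  exact (key s).1

theorem IsDisjointSeq.smul {f : ℕ → F} (hf : IsDisjointSeq f) (a : ℕ → ℝ) :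
    IsDisjointSeq fun n => a n • f n := by
  intro i j hij
  simp only [lattice_abs_smul]
  refine inf_smul_eq_zero (smul_nonneg (abs_nonneg _) (abs_nonneg _)) (abs_nonneg _)
    (abs_nonneg _) ?_
  rw [inf_comm]
  exact inf_smul_eq_zero (abs_nonneg _) (abs_nonneg _) (abs_nonneg _) (hf j i hij.symm)

variable [HasSolidNorm F]

/-- The modulus of a disjoint sum dominates that of each term. For unit vectors this bounds all
coordinates by the norm of the sum. -/
theorem IsDisjointSeq.abs_coeff_mul_norm_le {f : ℕ → F} (hf : IsDisjointSeq f) (a : ℕ → ℝ)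
    (s : Finset ℕ) {k : ℕ} (hk : k ∈ s) : |a k| * ‖f k‖ ≤ ‖∑ i ∈ s, a i • f i‖ := by
  rw [← Real.norm_eq_abs, ← norm_smul]
  refine norm_le_norm_of_abs_le_abs ?_
  rw [hf.abs_sum_smul, lattice_abs_smul]
  exact Finset.single_le_sum (f := fun i => |a i| • |f i|)
    (fun i _ => smul_nonneg (abs_nonneg _) (abs_nonneg _)) hk

theorem IsDisjointSeq.linearIndependent {f : ℕ → F} (hf : IsDisjointSeq f)
    (h0 : ∀ n, f n ≠ 0) : LinearIndependent ℝ f := by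
  rw [linearIndependent_iff']
  intro s a ha i hi
  have h := hf.abs_coeff_mul_norm_le a s hi
  rw [ha, norm_zero] at h
  have h1 : |a i| ≤ 0 := nonpos_of_mul_nonpos_left h (norm_pos_iff.mpr (h0 i))
  exact abs_nonpos_iff.mp h1

end VectorLattice

/-! ### Order continuity of the dual norm and disjoint sequences -/

section OrderContinuousDual

variable {F : Type u} [NormedAddCommGroup F] [NormedSpace ℝ F] [Lattice F] [IsOrderedAddMonoid F]

theorem orderContinuousPart_eq_univ (h : HasOrderContinuousNorm (StrongDual ℝ F)) :
    orderContinuousPart (StrongDual ℝ F) = Set.univ := by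
  refine Set.eq_univ_of_forall fun ν => ⟨⊤, fun _ _ _ _ => trivial, ?_, trivial⟩
  intro D hne hD hglb ε hε
  obtain ⟨_, ⟨d, hd, rfl⟩, h'⟩ := h (Subtype.val '' D) (hne.image _) (by
    rintro _ ⟨a, ha, rfl⟩ _ ⟨b, hb, rfl⟩
    obtain ⟨c, hc, h1, h2⟩ := hD a ha b hb
    exact ⟨c, ⟨c, hc, rfl⟩, h1, h2⟩) ⟨by
      rintro _ ⟨a, ha, rfl⟩
      exact hglb.1 ha, fun ψ hψ => by
      have h1 : (⟨ψ, trivial⟩ : (⊤ : Submodule ℝ (StrongDual ℝ F))) ≤ 0 :=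
        hglb.2 fun a ha => hψ ⟨a, ha, rfl⟩
      exact h1⟩ ε hε
  exact ⟨d, hd, h'⟩

variable [HasSolidNorm F]

/-- Functionals in the order continuous part of the dual vanish along bounded disjoint sequences. -/
theorem tendsto_apply_abs_of_mem_orderContinuousPart {ν : StrongDual ℝ F} (hν : 0 ≤ ν)
    (hmem : ν ∈ orderContinuousPart (StrongDual ℝ F)) {f : ℕ → F} (hf : IsDisjointSeq f)
    {M : ℝ} (hM : ∀ n, ‖f n‖ ≤ M) : Tendsto (fun n => ν |f n|) atTop (𝓝 0) := by
  obtain ⟨I, hI, hoc, hνI⟩ := hmem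
  -- Positive vectors supported on some finite block starting at `m`; `φ m` below is the component
  -- of `ν` carried by this tail.
  let S : ℕ → AddSubmonoid F := fun m =>
    { carrier := {u | ∃ n, SupportedOnBlock f m n u}
      zero_mem' := ⟨0, le_rfl, fun v hv _ => inf_eq_right.mpr hv⟩
      add_mem' := by
        rintro a b ⟨n, ha⟩ ⟨n', hb⟩
        have ha' := ha.mono le_rfl (le_max_left n n')
        have hb' := hb.mono le_rfl (le_max_right n n')
        exact ⟨max n n', add_nonneg ha.1 hb.1, fun v hv hvi =>
          inf_add_eq_zero ha.1 hb.1 hv (ha'.2 v hv hvi) (hb'.2 v hv hvi)⟩ }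
  have hS0 : ∀ m, ∀ u ∈ S m, 0 ≤ u := by
    rintro m u ⟨n, hu⟩
    exact hu.1
  have hSf : ∀ m j, m ≤ j → |f j| ∈ S m := fun m j hmj =>
    ⟨j + 1, abs_nonneg _, fun v _ hvi => hvi j hmj (Nat.lt_succ_self j)⟩
  choose φ hφ0 hφν hle hub using fun m => exists_dual_component hν (S m) (hS0 m)
  have hanti : ∀ m m', m ≤ m' → φ m' ≤ φ m := fun m m' hmm x hx =>
    hub m' x hx _ fun u ⟨n, hu⟩ => hle m x hx u ⟨n, hu.mono hmm le_rfl⟩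
  have hφI : ∀ m, φ m ∈ I := fun m => hI ν hνI _ fun z hz1 hz2 =>
    ⟨(hφν m).trans hz1, fun x hx => by
      have h1 := hφ0 m x hx
      have h2 := hν x hx
      have h3 := hz1 x hx
      simp only [zero_apply, neg_apply] at *
      linarith⟩
  have hdisj : ∀ {m n n' : ℕ} {u w : F}, SupportedOnBlock f m n u → SupportedOnBlock f n n' w →
      u ⊓ w = 0 := by
    intro m n n' u w hu hw
    rw [inf_comm]
    refine hu.2 w hw.1 fun i _ hin => ?_
    rw [inf_comm]
    exact hw.2 _ (abs_nonneg _) fun j hj _ => hf i j (by omega)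
  -- Otherwise successive disjoint blocks each carry more than `ε / 2` of the mass of `x`, and
  -- enough of them exceed `ν x`.
  have hinf : ∀ x, 0 ≤ x → ∀ ε, 0 < ε → ∃ m, φ m x < ε := by
    intro x hx ε hε
    by_contra! hcon
    have hstep : ∀ m, ∃ u ∈ S m, ε / 2 < ν (x ⊓ u) := by
      intro m
      by_contra! h
      have := hub m x hx _ h
      linarith [hcon m]
    have hsum : ∀ N : ℕ, ∃ n u, SupportedOnBlock f 0 n u ∧ N * (ε / 2) ≤ ν (x ⊓ u) := by
      intro N
      induction N with
      | zero => exact ⟨0, 0, ⟨le_rfl, fun v hv _ => inf_eq_right.mpr hv⟩, by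
          simp [inf_eq_right.mpr hx]⟩
      | succ N ih =>
        obtain ⟨n, u, hu, hN⟩ := ih
        obtain ⟨w, ⟨k, hw⟩, hwε⟩ := hstep n
        refine ⟨max n k, u + w, ⟨add_nonneg hu.1 hw.1, fun v hv hvi =>
          inf_add_eq_zero hu.1 hw.1 hv ((hu.mono le_rfl (le_max_left n k)).2 v hv hvi)
            ((hw.mono (Nat.zero_le _) (le_max_right n k)).2 v hv hvi)⟩, ?_⟩
        have h1 := dual_mono hν (inf_add_inf_le_inf_add hx hu.1 hw.1 (hdisj hu hw))
        rw [map_add] at h1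
        push_cast
        linarith
    obtain ⟨N, hN⟩ := exists_nat_gt (ν x / (ε / 2))
    obtain ⟨_, u, _, hu⟩ := hsum N
    have h1 : ν (x ⊓ u) ≤ ν x := dual_mono hν inf_le_left
    rw [div_lt_iff₀ (by linarith)] at hN
    linarith
  have hsmall : ∀ ε, 0 < ε → ∃ m, ‖φ m‖ < ε := by
    intro ε hε
    obtain ⟨_, ⟨m, rfl⟩, hm⟩ := hoc (Set.range fun m => (⟨φ m, hφI m⟩ : I)) (Set.range_nonempty _)
      (by
        rintro _ ⟨a, rfl⟩ _ ⟨b, rfl⟩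
        exact ⟨_, ⟨max a b, rfl⟩, hanti _ _ (le_max_left a b), hanti _ _ (le_max_right a b)⟩)
      ⟨by rintro _ ⟨m, rfl⟩; exact hφ0 m, fun ψ hψ x hx => by
        change (ψ : StrongDual ℝ F) x ≤ 0
        refine le_of_forall_pos_lt_add fun ε hε => ?_
        obtain ⟨m, hm⟩ := hinf x hx ε hε
        have : (ψ : StrongDual ℝ F) x ≤ φ m x := hψ ⟨m, rfl⟩ x hx
        linarith⟩ ε hε
    exact ⟨m, hm⟩
  have hM0 : 0 ≤ M := (norm_nonneg _).trans (hM 0)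
  rw [Metric.tendsto_atTop]
  intro ε hε
  -- For `n ≥ m`, `ν |f n| ≤ φ m |f n| ≤ ‖φ m‖ * M`; the `M + 1` allows `M = 0`.
  obtain ⟨m, hm⟩ := hsmall (ε / (M + 1)) (by positivity)
  refine ⟨m, fun n hn => ?_⟩
  rw [Real.dist_eq, sub_zero, abs_of_nonneg (dual_apply_nonneg hν (abs_nonneg _))]
  have h1 := hle m |f n| (abs_nonneg _) _ (hSf m n hn)
  rw [inf_idem] at h1
  rw [lt_div_iff₀ (by linarith)] at hm
  nlinarith [dual_apply_abs_le (φ m) (f n), hM n, norm_nonneg (φ m)]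

/-- A downward directed family of functionals with infimum `0` tends to `0` pointwise on the
positive cone. -/
theorem exists_dual_apply_lt {D : Set (StrongDual ℝ F)} (hne : D.Nonempty)
    (hD : DirectedOn (fun x y => y ≤ x) D) (hglb : IsGLB D 0) {x : F} (hx : 0 ≤ x) {ε : ℝ}
    (hε : 0 < ε) : ∃ d ∈ D, d x < ε := by
  have : Nonempty D := hne.to_subtype
  -- Directedness makes the pointwise infimum additive, so it is a functional; being a lower bound
  -- of `D`, it is at most `0`.
  let p : F → ℝ := fun x => ⨅ d : D, (d : StrongDual ℝ F) x
  have h0 : ∀ d : D, ∀ x, 0 ≤ x → 0 ≤ (d : StrongDual ℝ F) x := fun d x hx => hglb.1 d.2 x hx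
  have hb : ∀ x, 0 ≤ x → BddBelow (Set.range fun d : D => (d : StrongDual ℝ F) x) := fun x hx =>
    ⟨0, by rintro _ ⟨d, rfl⟩; exact h0 d x hx⟩
  have hle : ∀ x, 0 ≤ x → ∀ d : D, p x ≤ (d : StrongDual ℝ F) x := fun x hx d =>
    ciInf_le (hb x hx) d
  obtain ⟨ν, hν⟩ := hne
  obtain ⟨φ, hφ⟩ := exists_dual_eq_of_additive (ν := ν) p (by
    intro x y hx hy
    refine le_antisymm ?_ (le_ciInf fun d => ?_)
    · rw [← sub_le_iff_le_add]
      refine le_ciInf fun d => ?_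
      rw [sub_le_comm]
      refine le_ciInf fun d' => ?_
      obtain ⟨c, hc, h1, h2⟩ := hD d d.2 d' d'.2
      have h3 := hle (x + y) (add_nonneg hx hy) ⟨c, hc⟩
      rw [map_add] at h3
      have h4 := h1 x hx
      have h5 := h2 y hy
      linarith
    · rw [map_add]
      exact add_le_add (hle x hx d) (hle y hy d)) (fun x hx => le_ciInf fun d => h0 d x hx)
    (fun x hx => hle x hx ⟨ν, hν⟩)
  have hφ0 : φ ≤ 0 := hglb.2 fun d hd x hx => by rw [hφ x hx]; exact hle x hx ⟨d, hd⟩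
  have h1 : p x < ε := by
    rw [← hφ x hx]
    exact (hφ0 x hx).trans_lt hε
  obtain ⟨d, hd⟩ := exists_lt_of_ciInf_lt h1
  exact ⟨d, d.2, hd⟩

theorem exists_nonneg_lt_apply {d : StrongDual ℝ F} (hd : 0 ≤ d) {r : ℝ} (hr : r < ‖d‖) :
    ∃ x, 0 ≤ x ∧ ‖x‖ ≤ 1 ∧ r < d x := by
  obtain ⟨x, hx, hrx⟩ := d.exists_lt_apply_of_lt_opNorm hr
  exact ⟨|x|, abs_nonneg x, (norm_abs_eq_norm x).trans_le hx.le,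
    hrx.trans_le (abs_dual_apply_le hd x)⟩

variable [IsOrderedModule ℝ F] [CompleteSpace F]

/-- If the dual norm is not order continuous, then some positive functional is bounded away from
zero on a bounded disjoint sequence of positive vectors. -/
theorem exists_disjoint_of_not_hasOrderContinuousNorm
    (h : ¬ HasOrderContinuousNorm (StrongDual ℝ F)) :
    ∃ u : ℕ → F, IsDisjointSeq u ∧ (∀ n, 0 ≤ u n) ∧ (∀ n, ‖u n‖ ≤ 1) ∧
      ∃ ν : StrongDual ℝ F, 0 ≤ ν ∧ ∃ δ : ℝ, 0 < δ ∧ ∀ n, δ ≤ ν (u n) := by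
  unfold HasOrderContinuousNorm at h
  push Not at h
  obtain ⟨D, hne, hD, hglb, ε, hε, hDε⟩ := h
  obtain ⟨ν, hνD⟩ := hne
  have hν : 0 ≤ ν := hglb.1 hνD
  -- Some `d ∈ D` below `ν` is tiny on the prescribed `s`, yet `‖d‖ ≥ ε` gives a positive `x` in the
  -- unit ball with `d x > ε / 2`.
  have hstep : ∀ (n : ℕ) (s : F), ∃ x, 0 ≤ x ∧ ‖x‖ ≤ 1 ∧ ∃ d, 0 ≤ d ∧ d ≤ ν ∧
      4 ^ n * d |s| ≤ ε / 8 ∧ ε / 2 < d x := by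
    intro n s
    obtain ⟨d, hd, hds⟩ := exists_dual_apply_lt ⟨ν, hνD⟩ hD hglb (abs_nonneg s)
      (ε := ε / 8 / 4 ^ n) (by positivity)
    obtain ⟨c, hc, h1, h2⟩ := hD d hd ν hνD
    have hc0 : 0 ≤ c := hglb.1 hc
    obtain ⟨x, hx0, hx1, hx⟩ := exists_nonneg_lt_apply hc0 (r := ε / 2) (by linarith [hDε c hc])
    refine ⟨x, hx0, hx1, c, hc0, h2, ?_, hx⟩
    rw [lt_div_iff₀ (by positivity)] at hds
    have h3 := mul_le_mul_of_nonneg_left (h1 |s| (abs_nonneg s)) (by positivity : (0:ℝ) ≤ 4 ^ n)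
    linarith
  choose X hX0 hX1 d hd0 hdν hds hdx using hstep
  -- `s n` is the sum of the vectors `x i` with `i < n`, so the functional chosen at stage `n` is
  -- tiny on all earlier choices.
  let s : ℕ → F := fun n => Nat.rec 0 (fun n s => s + X n s) n
  let x : ℕ → F := fun n => X n (s n)
  have hs1 : ∀ n, s (n + 1) = s n + x n := fun n => rfl
  have hs0 : ∀ n, 0 ≤ s n := by
    intro n
    induction n with
    | zero => exact le_rfl
    | succ n ih => rw [hs1]; exact add_nonneg ih (hX0 _ _)
  have hsmono : Monotone s := monotone_nat_of_le_succ fun n => by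
    rw [hs1]; exact le_add_of_nonneg_right (hX0 _ _)
  have hxs : ∀ {i n}, i < n → x i ≤ s n := fun {i n} hin =>
    (by rw [hs1]; exact le_add_of_nonneg_left (hs0 i) : x i ≤ s (i + 1)).trans (hsmono hin)
  have hsum : Summable fun k => ((1 / 2 : ℝ) ^ k) • x k :=
    Summable.of_norm_bounded summable_geometric_two fun k => by
      rw [norm_smul, Real.norm_of_nonneg (by positivity)]
      exact mul_le_of_le_one_right (by positivity) (hX1 _ _)
  set y : F := ∑' k, ((1 / 2 : ℝ) ^ k) • x k with hy
  have hxy : ∀ k, ((1 / 2 : ℝ) ^ k) • x k ≤ y := fun k =>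
    hsum.le_tsum k fun j _ => smul_nonneg (by positivity) (hX0 _ _)
  have hy0 : 0 ≤ y := (smul_nonneg (by positivity) (hX0 _ _)).trans (hxy 0)
  -- Subtracting multiples of `s n` and `y` removes the overlap with earlier and later vectors
  -- respectively.
  let g : ℕ → F := fun n => x n - (4 ^ n : ℝ) • s n - ((1 / 2 : ℝ) ^ n) • y
  have hgx : ∀ n, g n ≤ x n := fun n => by
    refine (sub_le_self _ (smul_nonneg (by positivity) hy0)).trans
      (sub_le_self _ (smul_nonneg (by positivity) (hs0 n)))
  -- With `z = x n - 4⁻ᵐ x m`, one has `g n ≤ z` and `g m ≤ 4ᵐ z⁻`, while `z⁺` and `z⁻` are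
  -- disjoint.
  have hdisj : ∀ n m, n < m → (g n)⁺ ⊓ (g m)⁺ = 0 := by
    intro n m hnm
    have h1 : g n ≤ x n - ((1 / 4 : ℝ) ^ m) • x m := by
      refine sub_le_sub (sub_le_self _ (smul_nonneg (by positivity) (hs0 n))) ?_
      refine le_trans ?_ (smul_le_smul_of_nonneg_left (hxy m) (by positivity))
      rw [smul_smul, ← pow_add]
      refine smul_le_smul_of_nonneg_right ?_ (hX0 _ _)
      have e : (1 / 4 : ℝ) ^ m = (1 / 2) ^ (m + m) := by
        rw [← two_mul, pow_mul]; norm_num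
      rw [e]
      exact pow_le_pow_of_le_one (by norm_num) (by norm_num) (by omega)
    have h2 : g m ≤ (4 ^ m : ℝ) • (x n - ((1 / 4 : ℝ) ^ m) • x m)⁻ := by
      refine le_trans ?_ (smul_le_smul_of_nonneg_left (neg_le_negPart _) (by positivity))
      rw [neg_sub, smul_sub, smul_smul, ← mul_pow]
      norm_num only [one_pow, one_smul]
      exact (sub_le_self _ (smul_nonneg (by positivity) hy0)).trans
        (sub_le_sub_left (smul_le_smul_of_nonneg_left (hxs hnm) (by positivity)) _)
    refine inf_eq_zero_of_le (posPart_nonneg _) (posPart_nonneg _) (posPart_mono h1)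
      (sup_le h2 (smul_nonneg (by positivity) (negPart_nonneg _)))
      (inf_smul_eq_zero (posPart_nonneg _) (negPart_nonneg _) (by positivity)
        (posPart_inf_negPart_eq_zero _))
  obtain ⟨N, hN⟩ : ∃ N, ∀ n ≥ N, (1 / 2 : ℝ) ^ n * ν y < ε / 8 := by
    have h1 : Tendsto (fun n : ℕ => (1 / 2 : ℝ) ^ n * ν y) atTop (𝓝 (0 * ν y)) :=
      (tendsto_pow_atTop_nhds_zero_of_lt_one (by norm_num) (by norm_num)).mul_const _
    rw [zero_mul] at h1
    exact eventually_atTop.mp (h1.eventually_lt_const (by positivity))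
  refine ⟨fun n => (g (n + N))⁺, ?_, fun n => posPart_nonneg _, fun n => ?_, ν, hν, ε / 4,
    by positivity, fun n => ?_⟩
  · intro i j hij
    simp only [abs_of_nonneg (posPart_nonneg _)]
    rcases lt_or_gt_of_ne hij with h | h
    · exact hdisj _ _ (by omega)
    · rw [inf_comm]; exact hdisj _ _ (by omega)
  · exact (norm_le_norm_of_nonneg_of_le (posPart_nonneg _)
      (sup_le (hgx _) (hX0 _ _))).trans (hX1 _ _)
  -- `ν (g⁺) ≥ d (g⁺) ≥ d g`, which exceeds `ε / 2 - ε / 8 - ε / 8`; the shift by `N` controls the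
  -- `y` term.
  · have h1 := hdν (n + N) (s (n + N)) _ (posPart_nonneg (g (n + N)))
    have h2 := dual_mono (hd0 (n + N) (s (n + N))) (le_posPart (g (n + N)))
    have h3 := hds (n + N) (s (n + N))
    have h4 := hdx (n + N) (s (n + N))
    have h5 := hN (n + N) (by omega)
    have h6 := mul_le_mul_of_nonneg_left (hdν (n + N) (s (n + N)) y hy0)
      (by positivity : (0 : ℝ) ≤ (1 / 2) ^ (n + N))
    rw [abs_of_nonneg (hs0 _)] at h3
    simp only [g, map_sub, map_smul, smul_eq_mul, x] at h1 h2 h4 ⊢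
    linarith

end OrderContinuousDual

/-! ### Neighbourhoods in the aw-topology -/

section AbsoluteWeakTopology

variable {F : Type u} [NormedAddCommGroup F] [NormedSpace ℝ F] [Lattice F] [IsOrderedAddMonoid F]
  [IsOrderedModule ℝ F]

/-- The seminorms generating `absoluteWeakTopology A`. -/
noncomputable def absSeminormFamily (A : Set (StrongDual ℝ F)) :
    SeminormFamily ℝ F {ν : StrongDual ℝ F // ν ∈ A ∧ 0 ≤ ν} :=
  fun ν => absSeminorm ν.1 ν.2.2

theorem withSeminorms_absoluteWeakTopology (A : Set (StrongDual ℝ F))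
    [Nonempty {ν : StrongDual ℝ F // ν ∈ A ∧ 0 ≤ ν}] :
    WithSeminorms (topology := absoluteWeakTopology A) (absSeminormFamily A) :=
  WithSeminorms.mk (topology := absoluteWeakTopology A) rfl

theorem tendsto_nhds_absoluteWeakTopology {α : Type*} (A : Set (StrongDual ℝ F))
    [Nonempty {ν : StrongDual ℝ F // ν ∈ A ∧ 0 ≤ ν}] {l : Filter α} {g : α → F} {x : F} :
    Tendsto g l (@nhds F (absoluteWeakTopology A) x) ↔
      ∀ ν ∈ A, 0 ≤ ν → Tendsto (fun a => ν |g a - x|) l (𝓝 0) := by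
  refine (@WithSeminorms.tendsto_nhds _ _ _ _ _ _ _ (absoluteWeakTopology A)
    _ (withSeminorms_absoluteWeakTopology A) g l x).trans ⟨fun h ν hA hν => ?_, fun h i ε hε => ?_⟩
  · rw [Metric.tendsto_nhds]
    intro ε hε
    filter_upwards [h ⟨ν, hA, hν⟩ ε hε] with a ha
    rwa [Real.dist_eq, sub_zero, abs_of_nonneg ((absSeminorm_apply ν hν _).symm ▸
      apply_nonneg (absSeminorm ν hν) _)]
  · exact (h i.1 i.2.1 i.2.2).eventually_lt_const hε

/-- The sum of finitely many positive functionals dominates each of them, so one functional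
describes a basic neighbourhood. -/
theorem exists_dual_ball_subset_of_mem_nhds_aw {U : Set F} (hU : U ∈ @nhds F (awTopology F) 0) :
    ∃ ν : StrongDual ℝ F, 0 ≤ ν ∧ ∃ r : ℝ, 0 < r ∧ ∀ f, ν |f| < r → f ∈ U := by
  obtain ⟨s, r, hr, hs⟩ := (@WithSeminorms.mem_nhds_iff _ _ _ _ _ _ (awTopology F)
    _ (withSeminorms_absoluteWeakTopology Set.univ) 0 U).mp hU
  have hsum : ∀ f, (∑ i ∈ s, i.1) f = ∑ i ∈ s, i.1 f := fun f => by simp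
  refine ⟨∑ i ∈ s, i.1, fun f hf => ?_, r, hr, fun f hf => hs ?_⟩
  · rw [hsum]
    exact Finset.sum_nonneg fun i _ => by simpa using i.2.2 f hf
  · rw [Seminorm.mem_ball_zero]
    refine Seminorm.finset_sup_apply_lt hr fun i hi => ?_
    rw [absSeminormFamily, absSeminorm_apply]
    refine lt_of_le_of_lt ?_ hf
    rw [hsum]
    exact Finset.single_le_sum (f := fun i : {ν : StrongDual ℝ F // ν ∈ Set.univ ∧ 0 ≤ ν} =>
      i.1 |f|) (fun j _ => by simpa using j.2.2 |f| (abs_nonneg f)) hi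

theorem nhds_le_nhds_awTopology [HasSolidNorm F] (x : F) :
    𝓝 x ≤ @nhds F (awTopology F) x := by
  refine (tendsto_nhds_absoluteWeakTopology _ (g := id)).mpr fun ν _ hν => ?_
  have h : Tendsto (fun a : F => ‖ν‖ * ‖a - x‖) (𝓝 x) (𝓝 (‖ν‖ * 0)) :=
    (tendsto_iff_norm_sub_tendsto_zero.mp tendsto_id).const_mul _
  rw [mul_zero] at h
  exact squeeze_zero (fun a => dual_apply_nonneg hν (abs_nonneg _))
    (fun a => dual_apply_abs_le ν _) h

/-- If a positive functional bounds the norm on a subspace, the aw-topology agrees with the norm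
topology there. -/
theorem agreesWithNormOn_of_le [HasSolidNorm F] {E : Submodule ℝ F} {ν : StrongDual ℝ F}
    (hν : 0 ≤ ν) {c : ℝ} (h : ∀ e ∈ E, ‖e‖ ≤ c * ν |e|) : AgreesWithNormOn (awTopology F) E := by
  refine le_antisymm ?_ ?_
  · refine le_of_nhds_le_nhds fun e => ?_
    rw [@nhds_induced _ _ (awTopology F), nhds_subtype_eq_comap, ← tendsto_iff_comap]
    have h1 : Tendsto (fun a : E => (a : F)) (comap (fun a : E => (a : F))
        (@nhds F (awTopology F) e)) (@nhds F (awTopology F) e) := tendsto_comap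
    have h2 := ((tendsto_nhds_absoluteWeakTopology _).mp h1 ν trivial hν).const_mul c
    rw [mul_zero] at h2
    exact tendsto_iff_norm_sub_tendsto_zero.mpr
      (squeeze_zero (fun a => norm_nonneg _) (fun a => h _ (a - e).2) h2)
  · refine le_of_nhds_le_nhds fun e => ?_
    rw [@nhds_induced _ _ (awTopology F), ← tendsto_iff_comap]
    exact (continuous_subtype_val.tendsto e).mono_right (nhds_le_nhds_awTopology _)

/-- If no such pair existed, the aw- and `ρ`-neighbourhoods of `0` would trace a proper filter on
the unit sphere, null for both. -/
theorem Complements.exists_dual {ρ : Seminorm ℝ F} (h : Complements ρ (awTopology F)) :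
    ∃ ν : StrongDual ℝ F, 0 ≤ ν ∧ ∃ r : ℝ, 0 < r ∧
      ∀ f, ‖f‖ = 1 → ν |f| < r → r ≤ ρ f := by
  by_contra! hcon
  refine h ⟨@nhds F (awTopology F) 0 ⊓ comap ρ (𝓝 0) ⊓ 𝓟 {f | ‖f‖ = 1}, ?_,
    eventually_iff.mpr (mem_inf_of_right (mem_principal_self _)),
    tendsto_id.mono_left (inf_le_left.trans inf_le_left),
    tendsto_comap.mono_left (inf_le_left.trans inf_le_right)⟩
  rw [inf_principal_neBot_iff]
  intro W hW
  obtain ⟨U, hU, V, hV, rfl⟩ := mem_inf_iff.mp hW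
  obtain ⟨ν, hν, r, hr, hrU⟩ := exists_dual_ball_subset_of_mem_nhds_aw hU
  obtain ⟨V', hV', hVV⟩ := mem_comap.mp hV
  obtain ⟨δ, hδ, hδV⟩ := Metric.mem_nhds_iff.mp hV'
  have hk : 0 < min r δ := lt_min hr hδ
  obtain ⟨f, hf1, hf2, hf3⟩ := hcon ν hν (min r δ) hk
  refine ⟨f, ⟨hrU f (hf2.trans_le (min_le_left _ _)), hVV (hδV ?_)⟩, hf1⟩
  rw [Metric.mem_ball, Real.dist_eq, sub_zero, abs_of_nonneg (apply_nonneg ρ f)]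
  exact hf3.trans_le (min_le_right _ _)

end AbsoluteWeakTopology

/-! ### Complementing operators on disjoint sequences -/

section DisjointSequences

variable {F : Type u} [NormedAddCommGroup F] [NormedSpace ℝ F] [Lattice F] [IsOrderedAddMonoid F]
  [IsOrderedModule ℝ F]

theorem IsBoundedlyExhaustive.tendsto_apply_abs (h : IsBoundedlyExhaustive (awTopology F))
    {f : ℕ → F} (hf : IsDisjointSeq f) {M : ℝ} (hM : ∀ n, ‖f n‖ ≤ M) {ν : StrongDual ℝ F}
    (hν : 0 ≤ ν) : Tendsto (fun n => ν |f n|) atTop (𝓝 0) := by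
  have h1 := h f hf (isBounded_iff_forall_norm_le.mpr ⟨M, by rintro _ ⟨n, rfl⟩; exact hM n⟩)
  simpa using (tendsto_nhds_absoluteWeakTopology _).mp h1 ν trivial hν

/-- The normalization of a sequence of non-zero vectors. -/
theorem IsDisjointSeq.exists_normalize {f : ℕ → F} (hf : IsDisjointSeq f) (h0 : ∀ n, f n ≠ 0) :
    ∃ g : ℕ → F, IsDisjointSeq g ∧ (∀ n, ‖g n‖ = 1) ∧ ∀ n, g n = ‖f n‖⁻¹ • f n :=
  ⟨fun n => ‖f n‖⁻¹ • f n, hf.smul _, fun n => norm_smul_inv_norm (𝕜 := ℝ) (h0 n), fun _ => rfl⟩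

theorem isInftyDNS_of_isBoundedlyExhaustive {H : Type v} [NormedAddCommGroup H] [NormedSpace ℝ H]
    (h : IsBoundedlyExhaustive (awTopology F)) {T : F →L[ℝ] H}
    (hT : Complements (operatorSeminorm T) (awTopology F)) : IsInftyDNS T := by
  obtain ⟨ν, hν, r, hr, hνr⟩ := hT.exists_dual
  refine ⟨r / 2, by positivity, fun ⟨f, hf, hf1, hfT⟩ => ?_⟩
  obtain ⟨n, hn⟩ := ((h.tendsto_apply_abs hf (fun n => (hf1 n).le) hν).eventually_lt_const
    hr).exists
  have h1 : r ≤ ‖T (f n)‖ := hνr _ (hf1 n) hn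
  linarith [hfT n]

variable [HasSolidNorm F]

theorem IsDisjointSeq.not_finiteDimensional_span {f : ℕ → F} (hf : IsDisjointSeq f)
    (h0 : ∀ n, f n ≠ 0) : ¬ FiniteDimensional ℝ (Submodule.span ℝ (Set.range f)) := fun _ =>
  not_finite_iff_infinite.mpr inferInstance
    (Module.Finite.finite_basis (Module.Basis.span (hf.linearIndependent h0)))

/-- Along a sparse normalized subsequence `ν |·|` is summably small, hence at most `r / 2` times the
norm on the whole span, where `T` is then bounded below by `r`. -/
theorem isDNS_of_isBoundedlyExhaustive {H : Type v} [NormedAddCommGroup H] [NormedSpace ℝ H]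
    (h : IsBoundedlyExhaustive (awTopology F)) {T : F →L[ℝ] H}
    (hT : Complements (operatorSeminorm T) (awTopology F)) : IsDNS T := by
  obtain ⟨ν, hν, r, hr, hνr⟩ := hT.exists_dual
  intro f hf h0 hsing
  obtain ⟨g, hg, hg1, hgf⟩ := hf.exists_normalize h0
  have hlim := h.tendsto_apply_abs hg (fun n => (hg1 n).le) hν
  obtain ⟨k, hk, hkν⟩ := extraction_forall_of_eventually' (P := fun n m =>
      ν |g m| < r / 4 * (1 / 2) ^ n) fun n =>
    eventually_atTop.mp (hlim.eventually_lt_const (by positivity))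
  have hgk := hg.comp hk.injective
  have hgk1 : ∀ n, ‖(g ∘ k) n‖ = 1 := fun n => hg1 _
  refine hsing (Submodule.span ℝ (Set.range (g ∘ k))) (Submodule.span_le.mpr ?_)
    (hgk.not_finiteDimensional_span fun n => norm_ne_zero_iff.mp (by rw [hgk1]; exact one_ne_zero))
    ⟨r, hr, fun x hx => ?_⟩
  · rintro _ ⟨n, rfl⟩
    rw [Function.comp_apply, hgf]
    exact Submodule.smul_mem _ _ (Submodule.subset_span ⟨_, rfl⟩)
  have hxν : ν |x| ≤ r / 2 * ‖x‖ := by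
    obtain ⟨a, rfl⟩ := Finsupp.mem_span_range_iff_exists_finsupp.mp hx
    rw [Finsupp.sum, hgk.abs_sum_smul, map_sum]
    calc ∑ i ∈ a.support, ν (|a i| • |(g ∘ k) i|)
        ≤ ∑ i ∈ a.support, (r / 4 * ‖∑ i ∈ a.support, a i • (g ∘ k) i‖) * (1 / 2) ^ i := by
          refine Finset.sum_le_sum fun i hi => ?_
          have h1 := hgk.abs_coeff_mul_norm_le a a.support hi
          rw [hgk1, mul_one] at h1
          rw [map_smul, smul_eq_mul]
          refine (mul_le_mul h1 (hkν i).le (dual_apply_nonneg hν (abs_nonneg _))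
            (norm_nonneg _)).trans (le_of_eq (by ring))
      _ ≤ (r / 4 * ‖∑ i ∈ a.support, a i • (g ∘ k) i‖) * 2 := by
          rw [← Finset.mul_sum]
          refine mul_le_mul_of_nonneg_left ?_ (by positivity)
          exact (summable_geometric_two.sum_le_tsum _ fun i _ => by positivity).trans_eq
            tsum_geometric_two
      _ = r / 2 * ‖∑ i ∈ a.support, a i • (g ∘ k) i‖ := by ring
  rcases eq_or_ne x 0 with rfl | hx0
  · simp
  have hnx := norm_pos_iff.mpr hx0
  have h1 : r ≤ ‖T (‖x‖⁻¹ • x)‖ := by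
    refine hνr _ (norm_smul_inv_norm (𝕜 := ℝ) hx0) ?_
    rw [lattice_abs_smul, abs_of_pos (inv_pos.mpr hnx), map_smul, smul_eq_mul,
      inv_mul_lt_iff₀ hnx]
    nlinarith
  rw [map_smul, norm_smul, Real.norm_of_nonneg (inv_nonneg.mpr hnx.le),
    le_inv_mul_iff₀ hnx] at h1
  linarith

/-- An operator which is summable along a disjoint sequence of unit vectors is strictly singular on
the span of the sequence. -/
theorem IsDisjointSeq.isStrictlySingularOn_span {H : Type v} [NormedAddCommGroup H]
    [NormedSpace ℝ H] {T : F →L[ℝ] H} {g : ℕ → F} (hg : IsDisjointSeq g) (hg1 : ∀ n, ‖g n‖ = 1)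
    (hT : Summable fun n => ‖T (g n)‖) :
    IsStrictlySingularOn T (Submodule.span ℝ (Set.range g)) := by
  rintro G hG hinf ⟨c, hc, hcG⟩
  have hli := hg.linearIndependent fun n hn => by simpa [hn] using hg1 n
  obtain ⟨s, hs⟩ := summable_iff_vanishing_norm.mp hT (c / 2) (by positivity)
  -- Finitely many coordinates cannot separate an infinite-dimensional `G`: some nonzero `x ∈ G` has
  -- support off `s`, where `T` sums to less than `c / 2`.
  let L : G →ₗ[ℝ] (s → ℝ) := LinearMap.pi fun i =>
    (Finsupp.lapply (i : ℕ)) ∘ₗ (hli.repr : _ →ₗ[ℝ] (ℕ →₀ ℝ)) ∘ₗ Submodule.inclusion hG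
  have hL : ¬ Function.Injective L := fun hL => hinf (Module.Finite.of_injective L hL)
  rw [← LinearMap.ker_eq_bot, Submodule.eq_bot_iff] at hL
  push Not at hL
  obtain ⟨x, hxL, hx0⟩ := hL
  set a : ℕ →₀ ℝ := hli.repr (Submodule.inclusion hG x) with ha
  have hxa : (x : F) = ∑ i ∈ a.support, a i • g i := by
    have := hli.linearCombination_repr (Submodule.inclusion hG x)
    rw [← ha, Finsupp.linearCombination_apply, Finsupp.sum] at this
    exact this.symm
  have has : ∀ i ∈ s, a i = 0 := fun i hi => congrFun (LinearMap.mem_ker.mp hxL) ⟨i, hi⟩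
  have hdisj : Disjoint a.support s := Finset.disjoint_left.mpr fun i hi his =>
    Finsupp.mem_support_iff.mp hi (has i his)
  have hsmall := hs _ hdisj
  rw [Real.norm_of_nonneg (Finset.sum_nonneg fun i _ => norm_nonneg _)] at hsmall
  have hTx : ‖T x‖ ≤ ‖(x : F)‖ * (c / 2) := by
    calc ‖T x‖ = ‖∑ i ∈ a.support, a i • T (g i)‖ := by rw [hxa, map_sum]; simp only [map_smul]
      _ ≤ ∑ i ∈ a.support, ‖(x : F)‖ * ‖T (g i)‖ := by
          refine norm_sum_le_of_le _ fun i hi => ?_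
          have h1 := hg.abs_coeff_mul_norm_le a a.support hi
          rw [hg1, mul_one, ← hxa] at h1
          rw [norm_smul]
          exact mul_le_mul_of_nonneg_right h1 (norm_nonneg _)
      _ ≤ ‖(x : F)‖ * (c / 2) := by
          rw [← Finset.mul_sum]
          exact mul_le_mul_of_nonneg_left hsmall.le (norm_nonneg _)
  have hx : 0 < ‖(x : F)‖ := norm_pos_iff.mpr fun h => hx0 (Subtype.ext h)
  nlinarith [hcG x x.2]

end DisjointSequences

/-! ### Dispersed subspaces through quotient maps -/

section Quotient

variable {F : Type u} [NormedAddCommGroup F] [NormedSpace ℝ F]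

/-- The quotient map, with values in a copy of the quotient in a larger universe. -/
noncomputable def quotientULift (E : Submodule ℝ F) [IsClosed (E : Set F)] :
    F →L[ℝ] ULift.{v} (F ⧸ E) :=
  LinearMap.mkContinuous
    ((ULift.moduleEquiv (R := ℝ) (M := F ⧸ E)).symm.toLinearMap ∘ₗ E.mkQ) 1 fun x => by
      rw [one_mul]
      exact Submodule.Quotient.norm_mk_le E x

theorem norm_quotientULift (E : Submodule ℝ F) [IsClosed (E : Set F)] (x : F) :
    ‖quotientULift.{u, v} E x‖ = Metric.infDist x E :=
  QuotientAddGroup.norm_mk (S := E.toAddSubgroup) x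

theorem exists_mem_norm_sub_lt {E : Submodule ℝ F} {x : F} {r : ℝ}
    (h : Metric.infDist x (E : Set F) < r) : ∃ e ∈ E, ‖x - e‖ < r := by
  obtain ⟨e, he, h⟩ := (Metric.infDist_lt_iff ⟨0, E.zero_mem⟩).mp h
  exact ⟨e, he, by rwa [← dist_eq_norm]⟩

variable [Lattice F]

theorem isInftyDispersed_of_isInftyDNS {E : Submodule ℝ F} [IsClosed (E : Set F)]
    (h : IsInftyDNS (quotientULift.{u, v} E)) : IsInftyDispersed E := by
  obtain ⟨r, hr, h⟩ := h
  exact ⟨r, hr, fun ⟨f, hf, hf1, hfE⟩ =>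
    h ⟨f, hf, hf1, fun k => by rw [norm_quotientULift]; exact (hfE k).le⟩⟩

variable [IsOrderedAddMonoid F] [IsOrderedModule ℝ F] [HasSolidNorm F]

/-- For an aw-null net of unit vectors approaching `E`, nearby points of `E` are also aw-null, hence
norm null by agreement, which contradicts the unit norms. -/
theorem complements_quotientULift {E : Submodule ℝ F} [IsClosed (E : Set F)]
    (hE : AgreesWithNormOn (awTopology F) E) :
    Complements (operatorSeminorm (quotientULift.{u, v} E)) (awTopology F) := by
  rintro ⟨l, hl, hl1, hlaw, hlT⟩
  have hlT' : Tendsto (fun x => Metric.infDist x (E : Set F)) l (𝓝 0) := by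
    exact hlT.congr fun x => norm_quotientULift.{u, v} E x
  -- The distance need not be attained, hence the factor `2`; at distance `0`, closedness puts `x`
  -- itself in `E`.
  have hsel : ∀ x : F, ∃ e : E, ‖x - e‖ ≤ 2 * Metric.infDist x (E : Set F) := by
    intro x
    rcases (Metric.infDist_nonneg (x := x) (s := (E : Set F))).eq_or_lt with h0 | h0
    · have : x ∈ (E : Set F) :=
        (‹IsClosed (E : Set F)›.mem_iff_infDist_zero ⟨0, E.zero_mem⟩).mpr h0.symm
      exact ⟨⟨x, this⟩, by simp [← h0]⟩
    · obtain ⟨e, he, h⟩ := exists_mem_norm_sub_lt (show Metric.infDist x (E : Set F) <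
        2 * Metric.infDist x (E : Set F) by linarith)
      exact ⟨⟨e, he⟩, h.le⟩
  choose e he using hsel
  have hsub : Tendsto (fun x => ‖x - e x‖) l (𝓝 0) := by
    have h2 := hlT'.const_mul 2
    rw [mul_zero] at h2
    exact squeeze_zero (fun x => norm_nonneg _) he h2
  have heaw : Tendsto (fun x => (e x : F)) l (@nhds F (awTopology F) 0) := by
    refine (tendsto_nhds_absoluteWeakTopology _).mpr fun ν _ hν => ?_
    have h1 := (tendsto_nhds_absoluteWeakTopology _).mp hlaw ν trivial hν
    have h2 := h1.add (hsub.const_mul ‖ν‖)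
    rw [mul_zero, add_zero] at h2
    refine squeeze_zero (fun x => dual_apply_nonneg hν (abs_nonneg _)) (fun x => ?_) h2
    have h3 : |(e x : F) - 0| ≤ |id x - 0| + |x - e x| := by
      have := abs_add_le x (-(x - e x))
      rw [abs_neg] at this
      simpa using this
    have h4 := dual_mono hν h3
    rw [map_add] at h4
    linarith [dual_apply_abs_le ν (x - e x)]
  have henorm : Tendsto e l (𝓝 0) := by
    have h1 : Tendsto e l (@nhds E (TopologicalSpace.induced (fun e : E => (e : F))
        (awTopology F)) 0) := by
      rw [@nhds_induced _ _ (awTopology F), tendsto_comap_iff]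
      exact heaw
    rwa [hE] at h1
  have h1 := hsub.add henorm.norm
  rw [norm_zero, add_zero] at h1
  obtain ⟨x, hx, hx1⟩ := ((h1.eventually_lt_const one_pos).and hl1).exists
  have := norm_add_le (x - e x) (e x : F)
  rw [sub_add_cancel, hx1] at this
  exact absurd hx (not_lt.mpr this)

/-- An almost disjoint sequence in `E` has a subsequence whose disjoint approximants, normalized,
have summable images in the quotient; the quotient map is then strictly singular on their span. -/
theorem isDispersed_of_isDNS {E : Submodule ℝ F} [IsClosed (E : Set F)]
    (h : IsDNS (quotientULift.{u, v} E)) : IsDispersed E := by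
  rintro ⟨e, f, he, hf, hlim⟩
  -- The factor `1 / 2` ensures `‖f (k n)‖ ≥ 1 / 2`, so normalizing leaves the bound `(1 / 2) ^ n`.
  obtain ⟨k, hk, hkf⟩ := extraction_forall_of_eventually' (P := fun n m =>
      ‖f m - e m‖ < 1 / 2 * (1 / 2) ^ n) fun n =>
    eventually_atTop.mp (hlim.eventually_lt_const (by positivity))
  have hfk : ∀ n, 1 / 2 ≤ ‖f (k n)‖ := by
    intro n
    have h1 := norm_sub_norm_le (e (k n)) (f (k n))
    rw [norm_sub_rev, (he _).2] at h1
    have h2 : (1 / 2 : ℝ) ^ n ≤ 1 := pow_le_one₀ (by norm_num) (by norm_num)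
    linarith [hkf n]
  have hf0 : ∀ n, (f ∘ k) n ≠ 0 := fun n =>
    norm_pos_iff.mp (lt_of_lt_of_le (by norm_num) (hfk n))
  obtain ⟨g, hg, hg1, hgf⟩ := (hf.comp hk.injective).exists_normalize hf0
  have hspan : Submodule.span ℝ (Set.range g) = Submodule.span ℝ (Set.range (f ∘ k)) := by
    refine le_antisymm (Submodule.span_le.mpr ?_) (Submodule.span_le.mpr ?_)
    · rintro _ ⟨n, rfl⟩
      rw [hgf]
      exact Submodule.smul_mem _ _ (Submodule.subset_span ⟨_, rfl⟩)
    · rintro _ ⟨n, rfl⟩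
      have : (f ∘ k) n = ‖(f ∘ k) n‖ • g n := by
        rw [hgf, smul_smul, mul_inv_cancel₀ (norm_ne_zero_iff.mpr (hf0 n)), one_smul]
      rw [this]
      exact Submodule.smul_mem _ _ (Submodule.subset_span ⟨_, rfl⟩)
  refine h (f ∘ k) (hf.comp hk.injective) hf0 (hspan ▸ hg.isStrictlySingularOn_span hg1 ?_)
  refine Summable.of_nonneg_of_le (fun n => norm_nonneg _) (fun n => ?_) summable_geometric_two
  have h1 : ‖quotientULift.{u, v} E (f (k n))‖ ≤ 1 / 2 * (1 / 2) ^ n := by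
    rw [norm_quotientULift]
    refine (Metric.infDist_le_dist_of_mem (he (k n)).1).trans ?_
    rw [dist_eq_norm]
    exact (hkf n).le
  rw [hgf, map_smul, norm_smul, norm_inv, norm_norm,
    inv_mul_le_iff₀ (norm_pos_iff.mpr (hf0 n))]
  exact h1.trans (mul_le_mul_of_nonneg_right (hfk n) (by positivity))

end Quotient

/-! ### Closing the cycle of implications -/

section Main

variable {F : Type u} [NormedAddCommGroup F] [NormedSpace ℝ F] [Lattice F] [IsOrderedAddMonoid F]
  [IsOrderedModule ℝ F]

theorem awTopology_eq_aawTopology (h : HasOrderContinuousNorm (StrongDual ℝ F)) :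
    awTopology F = aawTopology F := by
  unfold awTopology aawTopology
  congr 1
  exact (orderContinuousPart_eq_univ h).symm

/-- Once normalized, a disjoint sequence in `E` is its own disjoint approximation. -/
theorem IsDispersed.not_mem_of_disjoint {E : Submodule ℝ F} (h : IsDispersed E) {f : ℕ → F}
    (hf : IsDisjointSeq f) (h0 : ∀ n, f n ≠ 0) : ¬ ∀ n, f n ∈ E := fun hE => by
  obtain ⟨g, hg, hg1, hgf⟩ := hf.exists_normalize h0
  exact h ⟨g, g, fun n => ⟨hgf n ▸ E.smul_mem _ (hE n), hg1 n⟩, hg, by simp⟩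

theorem IsInftyDispersed.not_mem_of_disjoint {E : Submodule ℝ F} (h : IsInftyDispersed E)
    {f : ℕ → F} (hf : IsDisjointSeq f) (h0 : ∀ n, f n ≠ 0) : ¬ ∀ n, f n ∈ E := fun hE => by
  obtain ⟨g, hg, hg1, hgf⟩ := hf.exists_normalize h0
  obtain ⟨r, hr, h⟩ := h
  refine h ⟨g, hg, hg1, fun n => ?_⟩
  rwa [Metric.infDist_zero_of_mem (show g n ∈ (E : Set F) from hgf n ▸ E.smul_mem _ (hE n))]

variable [HasSolidNorm F]

theorem isBoundedlyExhaustive_aaw : IsBoundedlyExhaustive (aawTopology F) := by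
  intro f hf hb
  obtain ⟨M, hM⟩ := isBounded_iff_forall_norm_le.mp hb
  refine (tendsto_nhds_absoluteWeakTopology _).mpr fun ν hmem hν => ?_
  simpa using tendsto_apply_abs_of_mem_orderContinuousPart hν hmem hf fun n => hM _ ⟨n, rfl⟩

/-- On the closed span of a bounded disjoint sequence of positive vectors on which a positive
functional is bounded away from zero, the aw-topology agrees with the norm topology. -/
theorem IsDisjointSeq.agreesWithNormOn_closure_span {f : ℕ → F} (hf : IsDisjointSeq f)
    (hf0 : ∀ n, 0 ≤ f n) (hf1 : ∀ n, ‖f n‖ ≤ 1) {ν : StrongDual ℝ F} (hν : 0 ≤ ν) {δ : ℝ}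
    (hδ : 0 < δ) (hνf : ∀ n, δ ≤ ν (f n)) :
    AgreesWithNormOn (awTopology F) (Submodule.span ℝ (Set.range f)).topologicalClosure := by
  refine agreesWithNormOn_of_le hν (c := δ⁻¹) fun x hx => ?_
  have hcont : Continuous fun x : F => δ⁻¹ * ν |x| := by
    refine continuous_const.mul (ν.continuous.comp ?_)
    exact continuous_id.sup continuous_neg
  refine closure_minimal (s := (Submodule.span ℝ (Set.range f) : Set F))
    (t := {x | ‖x‖ ≤ δ⁻¹ * ν |x|}) ?_ (isClosed_le continuous_norm hcont) hx
  intro x hx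
  obtain ⟨a, rfl⟩ := Finsupp.mem_span_range_iff_exists_finsupp.mp hx
  rw [Set.mem_ofPred_eq, Finsupp.sum, hf.abs_sum_smul, map_sum, Finset.mul_sum]
  -- Termwise `‖f i‖ ≤ 1 ≤ δ⁻¹ * ν (f i)`: the `ℓ¹` estimate.
  refine norm_sum_le_of_le _ fun i _ => ?_
  rw [norm_smul, Real.norm_eq_abs, abs_of_nonneg (hf0 i), map_smul, smul_eq_mul, mul_left_comm]
  refine mul_le_mul_of_nonneg_left ((hf1 i).trans ?_) (abs_nonneg _)
  rw [le_inv_mul_iff₀ hδ, mul_one]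
  exact hνf i

end Main

theorem mainTheorem3 (F : Type u) [NormedAddCommGroup F] [NormedSpace ℝ F] [CompleteSpace F]
    [Lattice F] [IsOrderedAddMonoid F] [IsOrderedModule ℝ F] [HasSolidNorm F] :
    List.TFAE [
      HasOrderContinuousNorm (StrongDual ℝ F),
      awTopology F = aawTopology F,
      IsBoundedlyExhaustive (awTopology F),
      ∀ (H : Type (max u v)) [NormedAddCommGroup H] [NormedSpace ℝ H] [CompleteSpace H]
        (T : F →L[ℝ] H), Complements (operatorSeminorm T) (awTopology F) → IsDNS T,
      ∀ (H : Type (max u v)) [NormedAddCommGroup H] [NormedSpace ℝ H] [CompleteSpace H]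
        (T : F →L[ℝ] H), Complements (operatorSeminorm T) (awTopology F) → IsInftyDNS T,
      ∀ E : Submodule ℝ F, IsClosed (E : Set F) → AgreesWithNormOn (awTopology F) E →
        IsDispersed E,
      ∀ E : Submodule ℝ F, IsClosed (E : Set F) → AgreesWithNormOn (awTopology F) E →
        IsInftyDispersed E,
      ∀ f : ℕ → F, IsDisjointSeq f → (∀ n, f n ≠ 0) →
        ¬ AgreesWithNormOn (awTopology F) (Submodule.span ℝ (Set.range f)).topologicalClosure] := by
  -- Two parallel branches, plain and `∞`, leave exhaustiveness and meet again at the last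
  -- condition.
  tfae_have 1 → 2 := awTopology_eq_aawTopology
  tfae_have 2 → 3 := fun h => h ▸ isBoundedlyExhaustive_aaw
  tfae_have 3 → 4 := fun h H _ _ _ T hT => isDNS_of_isBoundedlyExhaustive h hT
  tfae_have 3 → 5 := fun h H _ _ _ T hT => isInftyDNS_of_isBoundedlyExhaustive h hT
  tfae_have 4 → 6 := fun h E hE hagree =>
    haveI : IsClosed (E : Set F) := hE
    isDispersed_of_isDNS.{u, v} (h _ _ (complements_quotientULift hagree))
  tfae_have 5 → 7 := fun h E hE hagree =>
    haveI : IsClosed (E : Set F) := hE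
    isInftyDispersed_of_isInftyDNS.{u, v} (h _ _ (complements_quotientULift hagree))
  tfae_have 6 → 8 := fun h f hf h0 hagree =>
    (h _ (Submodule.isClosed_topologicalClosure _) hagree).not_mem_of_disjoint hf h0 fun n =>
      Submodule.le_topologicalClosure _ (Submodule.subset_span ⟨n, rfl⟩)
  tfae_have 7 → 8 := fun h f hf h0 hagree =>
    (h _ (Submodule.isClosed_topologicalClosure _) hagree).not_mem_of_disjoint hf h0 fun n =>
      Submodule.le_topologicalClosure _ (Submodule.subset_span ⟨n, rfl⟩)
  tfae_have 8 → 1 := fun h => by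
    by_contra hcon
    obtain ⟨f, hf, hf0, hf1, ν, hν, δ, hδ, hνf⟩ :=
      exists_disjoint_of_not_hasOrderContinuousNorm hcon
    refine h f hf (fun n hn => ?_) (hf.agreesWithNormOn_closure_span hf0 hf1 hν hδ hνf)
    have := hνf n
    rw [hn, map_zero] at this
    linarith
  tfae_finish
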